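/- Let $\Bbbk$ be a field, $S=\Bbbk[x_0,\ldots,x_n]$, and let $I\subseteq S$ be an ideal of projective dimension zero, i.e. $I$ is homogeneous and, with $R=S/I=\bigoplus_d R_d$, there is an integer $m_0>0$ with $\dim_\Bbbk R_i=m_0$ for all sufficiently large $i$. Let $I^u$ be the intersection of those components of a minimal primary decomposition of $I$ whose radical is not $(x_0,\ldots,x_n)$. For a homogeneous ideal $J$ let $\mathrm{post}(S/J)$ be the least $i$ with $\dim_\Bbbk (S/J)_i=\dim_\Bbbk (S/J)_{i+1}=\cdots$, and put $\mathrm{nz}=\max(\mathrm{post}(S/I),\mathrm{post}(S/I^u))$. Let $V(I)\subseteq\mathbb P^n(\Bbbk)$ be the set of $\Bbbk$-rational projective zeros of $I$, and fix for each point of $\mathbb P^n(\Bbbk)$ a representative in $\Bbbk^{n+1}\setminus\{0\}$, so that polynomials can be evaluated at projective points. Suppose that $\Bbbk$ has at least $|V(I)|$ elements. Let $e_1,\ldots,e_m\in S$ be such that $\{[e_1],\ldots,[e_m]\}$ is a $\Bbbk$-basis of $R_{\mathrm{nz}}$, and let $l\in S$ be a linear form such that $\{[e_1l],\ldots,[e_ml]\}$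 is a $\Bbbk$-basis of $R_{\mathrm{nz}+1}$. For $j=0,\ldots,n$ let $A_j=(a^{(j)}_{ki})\in\Bbbk^{m\times m}$ be the projective multiplication matrix defined by $[x_je_k]=\sum_{i=1}^m a^{(j)}_{ki}[e_il]$. Then $V(I)$ is finite, say $V(I)=\{p_1,\ldots,p_r\}$ with $r=|V(I)|$, and $A_0,\ldots,A_n$ have, up to multiplication by non-zero scalars, exactly $r$ common (right) eigenvectors in $\Bbbk^m$, namely $(e_1(p_i),\ldots,e_m(p_i))^t$ for $i=1,\ldots,r$: each of these vectors is a common eigenvector, and every common eigenvector is a non-zero scalar multiple of such a vector for exactly one $i$. If $\lambda_{ij}$ denotes the eigenvalue of $A_j$ corresponding to $(e_1(p_i),\ldots,e_m(p_i))^t$, then $p_i=(\lambda_{i0}:\lambda_{i1}:\cdots:\lambda_{in})$. -/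

import Mathlib

open MvPolynomial

noncomputable section

namespace ProjMult

attribute [local instance] MvPolynomial.gradedAlgebra

variable {k : Type*} [Field k] {n : ℕ}

/-- The degree `d` piece `R_d` of `R = S/I`, where `S = k[x_0, …, x_n]`: the classes of the forms
of degree `d`. -/
def gradedPiece (I : Ideal (MvPolynomial (Fin (n + 1)) k)) (d : ℕ) :
    Submodule k (MvPolynomial (Fin (n + 1)) k ⧸ I) :=
  (homogeneousSubmodule (Fin (n + 1)) k d).map (Ideal.Quotient.mkₐ k I).toLinearMap

/-- `I` is homogeneous and `dim_k R_i` is a positive constant for all sufficiently large `i`. -/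
def IsProjDimZero (I : Ideal (MvPolynomial (Fin (n + 1)) k)) : Prop :=
  I.IsHomogeneous (homogeneousSubmodule (Fin (n + 1)) k) ∧
    ∃ m : ℕ, 0 < m ∧ ∃ N : ℕ, ∀ i, N ≤ i → Module.finrank k (gradedPiece I i) = m

/-- The postulation number of `S/I`: the least `i` with `dim R_i = dim R_{i+1} = ⋯`. -/
def post (I : Ideal (MvPolynomial (Fin (n + 1)) k)) : ℕ :=
  sInf {i | ∀ j, i ≤ j → Module.finrank k (gradedPiece I j) = Module.finrank k (gradedPiece I i)}

open Classical in
/-- The ideal `I^u` computed from the set `t` of components of a minimal primary decomposition of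
`I`: the intersection of the components whose radical is not `(x_0, …, x_n)`. -/
def unmixedPart (t : Finset (Ideal (MvPolynomial (Fin (n + 1)) k))) :
    Ideal (MvPolynomial (Fin (n + 1)) k) :=
  (t.filter fun Q => Q.radical ≠ idealOfVars (Fin (n + 1)) k).inf id

/-- `nz(R) = max(post(R), post(R^u))` for `R = S/I`, where `t` is the set of components of a
minimal primary decomposition of `I`. -/
def nz (I : Ideal (MvPolynomial (Fin (n + 1)) k))
    (t : Finset (Ideal (MvPolynomial (Fin (n + 1)) k))) : ℕ :=
  max (post I) (post (unmixedPart t))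

/-- The `k`-rational projective variety of `I`. -/
def projVariety (I : Ideal (MvPolynomial (Fin (n + 1)) k)) :
    Set (Projectivization k (Fin (n + 1) → k)) :=
  {p | p.rep ∈ zeroLocus k I}

theorem mul_mem_gradedPiece (I : Ideal (MvPolynomial (Fin (n + 1)) k))
    {f : MvPolynomial (Fin (n + 1)) k} {c : ℕ} (hf : f.IsHomogeneous c) (d : ℕ)
    {a : MvPolynomial (Fin (n + 1)) k ⧸ I} (ha : a ∈ gradedPiece I d) :
    LinearMap.mulLeft k (Ideal.Quotient.mk I f) a ∈ gradedPiece I (d + c) := by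
  obtain ⟨g, hg, rfl⟩ := ha
  refine ⟨f * g, ?_, by simp⟩
  rw [add_comm d c]
  exact hf.mul hg

/-- Multiplication by a form `f` of degree `c`, as a `k`-linear map `R_d → R_{d+c}`. -/
def mulForm (I : Ideal (MvPolynomial (Fin (n + 1)) k))
    {f : MvPolynomial (Fin (n + 1)) k} {c : ℕ} (hf : f.IsHomogeneous c) (d : ℕ) :
    gradedPiece I d →ₗ[k] gradedPiece I (d + c) :=
  (LinearMap.mulLeft k (Ideal.Quotient.mk I f)).restrict
    fun _ ha => mul_mem_gradedPiece I hf d ha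

/-- The projective multiplication matrix of the variable `x_j` in degree `d` with respect to bases
`b` of `R_d` and `b'` of `R_{d+1}`: its `i`-th row is the coefficient vector of `x_j b_i` in the
basis `b'`, so it is the transpose of the usual matrix of the linear map. -/
def projMulMatrix (I : Ideal (MvPolynomial (Fin (n + 1)) k)) {d m : ℕ}
    (b : Module.Basis (Fin m) k (gradedPiece I d))
    (b' : Module.Basis (Fin m) k (gradedPiece I (d + 1))) (j : Fin (n + 1)) :
    Matrix (Fin m) (Fin m) k :=
  (LinearMap.toMatrix b b' (mulForm I (isHomogeneous_X k j) d)).transpose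

/-- `v` is a common (right) eigenvector of the matrices `A_0, …, A_n`, with eigenvalues
`lam 0, …, lam n`. -/
def HasCommonEigenvector {m : ℕ} (A : Fin (n + 1) → Matrix (Fin m) (Fin m) k)
    (lam : Fin (n + 1) → k) (v : Fin m → k) : Prop :=
  ∀ j, Module.End.HasEigenvector (Matrix.toLin' (A j)) (lam j) v

/-- `v` is a common (right) eigenvector of the matrices `A_0, …, A_n`. -/
def IsCommonEigenvector {m : ℕ} (A : Fin (n + 1) → Matrix (Fin m) (Fin m) k)
    (v : Fin m → k) : Prop :=
  ∃ lam : Fin (n + 1) → k, HasCommonEigenvector A lam v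

/-- The common eigenvectors counted up to non-zero scalars, as points of `P(k^m)`. -/
def commonEigenlines {m : ℕ} (A : Fin (n + 1) → Matrix (Fin m) (Fin m) k) :
    Set (Projectivization k (Fin m → k)) :=
  {L | IsCommonEigenvector A L.rep}

end ProjMult

end

open MvPolynomial

/-! Write `d` for `nz`. A vector `v` defines functionals `φ` on `R_d` and `ψ` on `R_{d+1}` with `φ
[e_i] = ψ [e_i l] = v_i`. Then `ψ(l g) = φ(g)`, and `v` being a common eigenvector means `ψ(x_j g) =
λ_j φ(g)`. Replacing the variables of a form one at a time by `λ_j l` shows that `l(λ) = 1` and that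
`φ`, `ψ` are one common non-zero multiple of evaluation at `λ` (`eq_eval_of_intertwined`). So the
forms of `I` of degrees `d` and `d + 1` vanish at `λ`. Lower degrees follow on multiplying by powers
of `l`; higher degrees follow because multiplication by `l ^ s` on `R_d` is bijective, the dimension
being constant from `d` on (`eigenvalues_mem_zeroLocus`).

Conversely, `l` vanishes at no point of `V(I)`, so each point has a representative `x` with `l(x) =
1`; evaluation at `x` gives an eigenvector with eigenvalues `x_j` (`hasCommonEigenvector_eval`). An
eigenvector determines its eigenvalues, hence its point. Finiteness of `V(I)` comes from
independence of characters (`finite_zeroLocus_inter`). -/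

namespace ProjMult

attribute [local instance] MvPolynomial.gradedAlgebra

/-! ### Forms, functionals on forms, and zeros of homogeneous ideals. -/

section Forms

variable {σ k : Type*} [Field k]

/-- A subspace containing the products of the variables with the forms of degree `a` contains the
forms of degree `a + 1`. -/
theorem homogeneousSubmodule_succ_le {a : ℕ} {p : Submodule k (MvPolynomial σ k)}
    (h : ∀ i g, g.IsHomogeneous a → X i * g ∈ p) : homogeneousSubmodule σ k (a + 1) ≤ p := by
  rw [← homogeneousSubmodule_one_pow, pow_succ', homogeneousSubmodule_one_pow,
    homogeneousSubmodule_one_eq_span_X, Submodule.mul_le]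
  intro u hu g hg
  induction hu using Submodule.span_induction with
  | mem x hx => obtain ⟨i, rfl⟩ := hx; exact h i g hg
  | zero => simp
  | add x y _ _ hx hy => rw [add_mul]; exact add_mem hx hy
  | smul r x _ hx => rw [smul_mul_assoc]; exact p.smul_mem r hx

theorem isHomogeneous_pow {l : MvPolynomial σ k} (hl : l.IsHomogeneous 1) (s : ℕ) :
    (l ^ s).IsHomogeneous s := by
  simpa using hl.pow s

/-- Two functionals `Φ` and `Ψ` on the forms of degree `d` and `d + 1`, intertwined by every
variable up to a scalar and by a linear form exactly, are multiples of the evaluation at the point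
formed by the scalars. -/
theorem eq_eval_of_intertwined {d : ℕ} {Φ Ψ : MvPolynomial σ k →ₗ[k] k} {lam : σ → k}
    {l : MvPolynomial σ k} (hl : l.IsHomogeneous 1)
    (hX : ∀ j g, g.IsHomogeneous d → Ψ (X j * g) = lam j * Φ g)
    (hΨl : ∀ g, g.IsHomogeneous d → Ψ (l * g) = Φ g)
    (hΦ : ∃ g, g.IsHomogeneous d ∧ Φ g ≠ 0) :
    eval lam l = 1 ∧ (∀ u, u.IsHomogeneous d → Φ u = eval lam u * Φ (l ^ d)) ∧
      ∀ u, u.IsHomogeneous (d + 1) → Ψ u = eval lam u * Φ (l ^ d) := by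
  have hlin : ∀ h : MvPolynomial σ k, h.IsHomogeneous 1 → ∀ g, g.IsHomogeneous d →
      Ψ (h * g) = eval lam h * Φ g := by
    intro h hh g hg
    rw [← mem_homogeneousSubmodule, homogeneousSubmodule_one_eq_span_X] at hh
    induction hh using Submodule.span_induction with
    | mem x hx => obtain ⟨i, rfl⟩ := hx; simpa using hX i g hg
    | zero => simp
    | add x y _ _ hx hy => simp [add_mul, hx, hy]
    | smul r x _ hx => simp [hx, mul_assoc]
  -- The cofactor `w` keeps the total degree equal to `d`, the only degree in which `Φ` is
  -- controlled, while the induction trades the factors of `u` for copies of `l`.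
  have hΦd : ∀ c w u, u.IsHomogeneous c → w.IsHomogeneous (d - c) → c ≤ d →
      Φ (u * w) = eval lam u * Φ (l ^ c * w) := by
    intro c
    induction c with
    | zero =>
      intro w u hu _ _
      rw [← mem_homogeneousSubmodule, homogeneousSubmodule_zero] at hu
      obtain ⟨r, rfl⟩ := Submodule.mem_one.1 hu
      simp [← smul_eq_C_mul]
    | succ c ih =>
      intro w u hu hw hc
      let f : MvPolynomial σ k →ₗ[k] k := Φ ∘ₗ LinearMap.mulRight k w
      let g : MvPolynomial σ k →ₗ[k] k :=
        (LinearMap.mulRight k (Φ (l ^ (c + 1) * w))) ∘ₗ (aeval lam).toLinearMap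
      suffices hle : homogeneousSubmodule σ k (c + 1) ≤ LinearMap.eqLocus f g by
        simpa [f, g, aeval_eq_eval] using hle hu
      refine homogeneousSubmodule_succ_le fun i u hu => ?_
      have hlw : (l * w).IsHomogeneous (d - c) := by
        have := hl.mul hw
        rwa [show 1 + (d - (c + 1)) = d - c by omega] at this
      have hXw : (X i * w).IsHomogeneous (d - c) := by
        have := (isHomogeneous_X k i).mul hw
        rwa [show 1 + (d - (c + 1)) = d - c by omega] at this
      have huX : (u * (X i * w)).IsHomogeneous d := by
        have := hu.mul hXw
        rwa [show c + (d - c) = d by omega] at this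
      have hul : (u * (l * w)).IsHomogeneous d := by
        have := hu.mul hlw
        rwa [show c + (d - c) = d by omega] at this
      -- Both sides equal `Ψ (X i * l * u * w)`, split off along `l` or along `X i`.
      have : Φ (u * (X i * w)) = lam i * Φ (u * (l * w)) := by
        rw [← hX i _ hul, ← hΨl _ huX]
        congr 1
        ring
      have e₁ := ih _ u hu hlw (by omega)
      simp only [LinearMap.mem_eqLocus, f, g, LinearMap.comp_apply, LinearMap.mulRight_apply,
        AlgHom.toLinearMap_apply, map_mul, aeval_X, aeval_eq_eval]
      rw [mul_assoc, mul_left_comm, this, e₁]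
      ring_nf
  have hΦ' : ∀ u, u.IsHomogeneous d → Φ u = eval lam u * Φ (l ^ d) := fun u hu => by
    simpa using hΦd d 1 u hu (by simpa using isHomogeneous_one σ k) le_rfl
  refine ⟨?_, hΦ', fun u hu => ?_⟩
  · obtain ⟨g, hg, hg0⟩ := hΦ
    have := hlin l hl g hg
    rw [hΨl g hg] at this
    exact (mul_right_cancel₀ hg0 (by rw [one_mul]; exact this)).symm
  · let g : MvPolynomial σ k →ₗ[k] k :=
      (LinearMap.mulRight k (Φ (l ^ d))) ∘ₗ (aeval lam).toLinearMap
    suffices hle : homogeneousSubmodule σ k (d + 1) ≤ LinearMap.eqLocus Ψ g by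
      simpa [g, aeval_eq_eval] using hle hu
    refine homogeneousSubmodule_succ_le fun i u hu => ?_
    simp [g, hX i u hu, hΦ' u hu, aeval_eq_eval, mul_assoc]

/-- If the forms of degree `d + 1` are multiples of `l` modulo `J`, then the forms of degree
`d + s` are multiples of `l ^ s` modulo `J`. -/
theorem exists_sub_pow_mul_mem {d : ℕ} {l : MvPolynomial σ k}
    {J : Ideal (MvPolynomial σ k)}
    (h : ∀ f, f.IsHomogeneous (d + 1) → ∃ g, g.IsHomogeneous d ∧ f - l * g ∈ J) (s : ℕ) :
    ∀ f, f.IsHomogeneous (d + s) → ∃ g, g.IsHomogeneous d ∧ f - l ^ s * g ∈ J := by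
  induction s with
  | zero => exact fun f hf => ⟨f, hf, by simp⟩
  | succ s ih =>
    suffices hle : homogeneousSubmodule σ k (d + s + 1) ≤
        (homogeneousSubmodule σ k d).map (LinearMap.mulLeft k (l ^ (s + 1))) ⊔
          J.restrictScalars k by
      intro f hf
      obtain ⟨_, ⟨g, hg, rfl⟩, z, hz, rfl⟩ := Submodule.mem_sup.1 (hle hf)
      exact ⟨g, hg, by simpa using hz⟩
    refine homogeneousSubmodule_succ_le fun i f hf => ?_
    obtain ⟨g, hg, hfg⟩ := ih f hf
    obtain ⟨g', hg', hgg'⟩ := h (X i * g) (by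
      rw [add_comm]; exact (isHomogeneous_X k i).mul hg)
    refine Submodule.mem_sup.2 ⟨l ^ (s + 1) * g', ⟨g', hg', rfl⟩,
      X i * (f - l ^ s * g) + l ^ s * (X i * g - l * g'), ?_, by ring⟩
    exact J.add_mem (J.mul_mem_left _ hfg) (J.mul_mem_left _ hgg')

theorem eval_smul_of_isHomogeneous {f : MvPolynomial σ k} {d : ℕ} (hf : f.IsHomogeneous d) (c : k)
    (x : σ → k) : eval (c • x) f = c ^ d * eval x f := by
  rw [eval_eq, eval_eq, Finset.mul_sum]
  refine Finset.sum_congr rfl fun s hs => ?_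
  have hd : s.degree = d := by
    by_contra hne
    exact mem_support_iff.1 hs (hf.coeff_eq_zero hne)
  simp only [Pi.smul_apply, smul_eq_mul, mul_pow, Finset.prod_mul_distrib,
    Finset.prod_pow_eq_pow_sum]
  rw [← hd, Finsupp.degree_apply]
  ring

theorem eval_eq_zero_of_mem_zeroLocus {I : Ideal (MvPolynomial σ k)} {x : σ → k}
    (hx : x ∈ zeroLocus k I) {f : MvPolynomial σ k} (hf : f ∈ I) : eval x f = 0 := by
  simpa [aeval_eq_eval] using hx f hf

theorem mem_zeroLocus_of_forms {I : Ideal (MvPolynomial σ k)}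
    (hI : I.IsHomogeneous (homogeneousSubmodule σ k)) {x : σ → k}
    (h : ∀ d f, f.IsHomogeneous d → f ∈ I → eval x f = 0) : x ∈ zeroLocus k I := by
  intro f hf
  rw [aeval_eq_eval, ← sum_homogeneousComponent f, map_sum]
  exact Finset.sum_eq_zero fun i _ => h i _ (homogeneousComponent_isHomogeneous i f)
    (homogeneousComponent_mem_of_mem hI hf i)

theorem smul_mem_zeroLocus {I : Ideal (MvPolynomial σ k)}
    (hI : I.IsHomogeneous (homogeneousSubmodule σ k)) {x : σ → k} (hx : x ∈ zeroLocus k I)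
    (c : k) : c • x ∈ zeroLocus k I :=
  mem_zeroLocus_of_forms hI fun d f hf hfI => by
    rw [eval_smul_of_isHomogeneous hf, eval_eq_zero_of_mem_zeroLocus hx hfI, mul_zero]

end Forms

/-! ### Graded pieces of the quotient and their bases. -/

section Pieces

variable {k : Type*} [Field k] {n : ℕ} {I : Ideal (MvPolynomial (Fin (n + 1)) k)}

/-- The class in `R_d` of the degree `d` component of a polynomial. -/
noncomputable def pieceClass (I : Ideal (MvPolynomial (Fin (n + 1)) k)) (d : ℕ) :
    MvPolynomial (Fin (n + 1)) k →ₗ[k] gradedPiece I d :=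
  ((Ideal.Quotient.mkₐ k I).toLinearMap ∘ₗ homogeneousComponent d).codRestrict _
    fun f => ⟨_, homogeneousComponent_mem d f, rfl⟩

theorem coe_pieceClass {d : ℕ} {f : MvPolynomial (Fin (n + 1)) k} (hf : f.IsHomogeneous d) :
    (pieceClass I d f : MvPolynomial (Fin (n + 1)) k ⧸ I) = Ideal.Quotient.mk I f := by
  change Ideal.Quotient.mk I (homogeneousComponent d f) = _
  rw [homogeneousComponent_eq_self hf]

theorem exists_pieceClass_eq {d : ℕ} (x : gradedPiece I d) :
    ∃ f : MvPolynomial (Fin (n + 1)) k, f.IsHomogeneous d ∧ pieceClass I d f = x := by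
  obtain ⟨f, hf, hfx⟩ := x.2
  exact ⟨f, hf, Subtype.ext ((coe_pieceClass hf).trans hfx)⟩

theorem pieceClass_eq_zero {d : ℕ} {f : MvPolynomial (Fin (n + 1)) k} (hf : f.IsHomogeneous d)
    (hfI : f ∈ I) : pieceClass I d f = 0 :=
  Subtype.ext ((coe_pieceClass hf).trans (Ideal.Quotient.eq_zero_iff_mem.2 hfI))

theorem mulForm_pieceClass {c d : ℕ} {f g : MvPolynomial (Fin (n + 1)) k} (hf : f.IsHomogeneous c)
    (hg : g.IsHomogeneous d) : mulForm I hf d (pieceClass I d g) = pieceClass I (d + c) (f * g) := by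
  refine Subtype.ext ?_
  rw [coe_pieceClass (by rw [add_comm d c]; exact hf.mul hg)]
  simp [mulForm, LinearMap.restrict_apply, coe_pieceClass hg]

variable {d m : ℕ} {e : Fin m → MvPolynomial (Fin (n + 1)) k}
  {b : Module.Basis (Fin m) k (gradedPiece I d)}

/-- The `e i` need not be forms; a form congruent to `e i` modulo `I` has the same values at the
zeros of `I` and makes degree arguments available. -/
theorem exists_form_of_basis
    (hb : ∀ i, (b i : MvPolynomial (Fin (n + 1)) k ⧸ I) = Ideal.Quotient.mk I (e i)) (i : Fin m) :
    ∃ f : MvPolynomial (Fin (n + 1)) k, f.IsHomogeneous d ∧ pieceClass I d f = b i ∧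
      f - e i ∈ I := by
  obtain ⟨f, hf, hfb⟩ := exists_pieceClass_eq (b i)
  refine ⟨f, hf, hfb, Ideal.Quotient.eq.1 ?_⟩
  rw [← coe_pieceClass hf, hfb, hb]

theorem exists_sub_sum_mem
    (hb : ∀ i, (b i : MvPolynomial (Fin (n + 1)) k ⧸ I) = Ideal.Quotient.mk I (e i))
    {f : MvPolynomial (Fin (n + 1)) k} (hf : f.IsHomogeneous d) :
    ∃ c : Fin m → k, f - ∑ i, c i • e i ∈ I := by
  refine ⟨fun i => b.repr (pieceClass I d f) i, Ideal.Quotient.eq.1 ?_⟩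
  rw [← coe_pieceClass hf]
  conv_lhs => rw [← b.sum_repr (pieceClass I d f)]
  have hsmul : ∀ (c : k) (g : MvPolynomial (Fin (n + 1)) k),
      Ideal.Quotient.mk I (c • g) = c • Ideal.Quotient.mk I g := fun c g => rfl
  simp only [AddSubmonoidClass.coe_finsetSum, Submodule.coe_smul, map_sum, hsmul, hb]

variable {l : MvPolynomial (Fin (n + 1)) k} {b' : Module.Basis (Fin m) k (gradedPiece I (d + 1))}

theorem mulForm_basis (hl : l.IsHomogeneous 1)
    (hb : ∀ i, (b i : MvPolynomial (Fin (n + 1)) k ⧸ I) = Ideal.Quotient.mk I (e i))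
    (hb' : ∀ i, (b' i : MvPolynomial (Fin (n + 1)) k ⧸ I) = Ideal.Quotient.mk I (e i * l))
    (i : Fin m) : mulForm I hl d (b i) = b' i :=
  Subtype.ext (by simp [mulForm, LinearMap.restrict_apply, hb, hb', mul_comm])

/-- Membership in the span of the degree `d + 1` forms of `I`, rather than in `I`, matters later:
only those generators are known to vanish at `lam` when higher degrees are treated. -/
theorem exists_sub_mul_mem_span (hl : l.IsHomogeneous 1)
    (hb : ∀ i, (b i : MvPolynomial (Fin (n + 1)) k ⧸ I) = Ideal.Quotient.mk I (e i))
    (hb' : ∀ i, (b' i : MvPolynomial (Fin (n + 1)) k ⧸ I) = Ideal.Quotient.mk I (e i * l))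
    (f : MvPolynomial (Fin (n + 1)) k) (hf : f.IsHomogeneous (d + 1)) :
    ∃ g : MvPolynomial (Fin (n + 1)) k, g.IsHomogeneous d ∧
      f - l * g ∈ Ideal.span {u | u ∈ I ∧ u.IsHomogeneous (d + 1)} := by
  have hsurj : Function.Surjective (mulForm I hl d) := by
    rw [← LinearMap.range_eq_top, eq_top_iff, ← b'.span_eq, Submodule.span_le]
    rintro _ ⟨i, rfl⟩
    exact ⟨b i, mulForm_basis hl hb hb' i⟩
  obtain ⟨y, hy⟩ := hsurj (pieceClass I (d + 1) f)
  obtain ⟨g, hg, rfl⟩ := exists_pieceClass_eq y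
  have hlg : (l * g).IsHomogeneous (d + 1) := by rw [add_comm d 1]; exact hl.mul hg
  refine ⟨g, hg, Ideal.subset_span ⟨Ideal.Quotient.eq.1 ?_, hf.sub hlg⟩⟩
  rw [← coe_pieceClass hf, ← coe_pieceClass hlg, ← hy, mulForm_pieceClass hl hg]

/-- If the forms of degree `d + s` are multiples of `l ^ s` modulo `I` and `R_d`, `R_{d+s}` have
the same dimension, then multiplication by `l ^ s` on `R_d` is injective. -/
theorem mem_of_pow_mul_mem [Module.Finite k (gradedPiece I d)] (hl : l.IsHomogeneous 1) {s : ℕ}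
    (hs : ∀ f, f.IsHomogeneous (d + s) → ∃ g, g.IsHomogeneous d ∧ f - l ^ s * g ∈ I)
    (hdim : Module.finrank k (gradedPiece I (d + s)) = Module.finrank k (gradedPiece I d))
    {g : MvPolynomial (Fin (n + 1)) k} (hg : g.IsHomogeneous d) (hlg : l ^ s * g ∈ I) : g ∈ I := by
  have hls := isHomogeneous_pow hl s
  have hlsg : ∀ g : MvPolynomial (Fin (n + 1)) k, g.IsHomogeneous d →
      (l ^ s * g).IsHomogeneous (d + s) := fun g hg => by
    rw [add_comm d s]; exact hls.mul hg
  have hsurj : Function.Surjective (mulForm I hls d) := by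
    intro y
    obtain ⟨f, hf, rfl⟩ := exists_pieceClass_eq y
    obtain ⟨g, hg, hfg⟩ := hs f hf
    refine ⟨pieceClass I d g, ?_⟩
    rw [mulForm_pieceClass hls hg]
    refine Subtype.ext ?_
    rw [coe_pieceClass hf, coe_pieceClass (hlsg g hg)]
    exact (Ideal.Quotient.eq.2 hfg).symm
  have : Module.Finite k (gradedPiece I (d + s)) := Module.Finite.of_surjective _ hsurj
  have hinj := (LinearMap.injective_iff_surjective_of_finrank_eq_finrank hdim.symm).2 hsurj
  have h0 : pieceClass I d g = 0 := hinj (by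
    rw [mulForm_pieceClass hls hg, pieceClass_eq_zero (hlsg g hg) hlg, map_zero])
  rw [← Ideal.Quotient.eq_zero_iff_mem, ← coe_pieceClass hg, h0]
  rfl

/-! ### Evaluation vectors at zeros of `I` and common eigenvectors. -/

theorem eval_smul_of_basis
    (hb : ∀ i, (b i : MvPolynomial (Fin (n + 1)) k ⧸ I) = Ideal.Quotient.mk I (e i))
    (hI : I.IsHomogeneous (homogeneousSubmodule (Fin (n + 1)) k))
    {x : Fin (n + 1) → k} (hx : x ∈ zeroLocus k I) (c : k) :
    (fun i => eval (c • x) (e i)) = c ^ d • fun i => eval x (e i) := by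
  ext i
  obtain ⟨f, hf, -, hfe⟩ := exists_form_of_basis hb i
  have h₁ := eval_eq_zero_of_mem_zeroLocus hx hfe
  have h₂ := eval_eq_zero_of_mem_zeroLocus (smul_mem_zeroLocus hI hx c) hfe
  rw [map_sub, sub_eq_zero] at h₁ h₂
  simp [← h₁, ← h₂, eval_smul_of_isHomogeneous hf]

theorem eval_eq_zero_of_eval_basis_eq_zero
    (hb : ∀ i, (b i : MvPolynomial (Fin (n + 1)) k ⧸ I) = Ideal.Quotient.mk I (e i))
    {x : Fin (n + 1) → k} (hx : x ∈ zeroLocus k I) {q : MvPolynomial (Fin (n + 1)) k}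
    (h : ∀ i, eval x (q * e i) = 0)
    {f : MvPolynomial (Fin (n + 1)) k} (hf : f.IsHomogeneous d) : eval x (q * f) = 0 := by
  obtain ⟨c, hc⟩ := exists_sub_sum_mem hb hf
  have h₁ := eval_eq_zero_of_mem_zeroLocus hx hc
  rw [map_sub, sub_eq_zero] at h₁
  simp only [map_mul] at h ⊢
  rw [h₁, map_sum, Finset.mul_sum]
  refine Finset.sum_eq_zero fun i _ => ?_
  rw [smul_eval, mul_left_comm, h, mul_zero]

/-- Otherwise every form of degree `d` would vanish at `x`, including `X j ^ d` for a coordinate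
with `x j ≠ 0`. -/
theorem eval_basis_ne_zero
    (hb : ∀ i, (b i : MvPolynomial (Fin (n + 1)) k ⧸ I) = Ideal.Quotient.mk I (e i))
    {x : Fin (n + 1) → k} (hx : x ∈ zeroLocus k I) (hx0 : x ≠ 0) :
    (fun i => eval x (e i)) ≠ 0 := by
  intro h
  obtain ⟨j, hj⟩ := Function.ne_iff.1 hx0
  have := eval_eq_zero_of_eval_basis_eq_zero hb hx (q := 1)
    (fun i => by simpa using congrFun h i) (isHomogeneous_pow (isHomogeneous_X k j) d)
  exact hj (eq_zero_of_pow_eq_zero (n := d) (by simpa using this))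

/-- The linear form `l` vanishes at no projective zero of `I`. -/
theorem eval_linearForm_ne_zero
    (hb' : ∀ i, (b' i : MvPolynomial (Fin (n + 1)) k ⧸ I) = Ideal.Quotient.mk I (e i * l))
    {x : Fin (n + 1) → k} (hx : x ∈ zeroLocus k I) (hx0 : x ≠ 0) : eval x l ≠ 0 := fun h =>
  eval_basis_ne_zero hb' hx hx0 (funext fun i => by simp [h])

/-- Evaluation at `x` factors through the quotient by `I`; apply it to the expansion of `x_j b_i` in
`b'`, where `l(x) = 1` turns `e_i l` into `e_i`. -/
theorem mulVec_projMulMatrix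
    (hb : ∀ i, (b i : MvPolynomial (Fin (n + 1)) k ⧸ I) = Ideal.Quotient.mk I (e i))
    (hb' : ∀ i, (b' i : MvPolynomial (Fin (n + 1)) k ⧸ I) = Ideal.Quotient.mk I (e i * l))
    {x : Fin (n + 1) → k} (hx : x ∈ zeroLocus k I) (hx1 : eval x l = 1) (j : Fin (n + 1)) :
    (projMulMatrix I b b' j).mulVec (fun i => eval x (e i)) = x j • fun i => eval x (e i) := by
  ext i
  let ev : (MvPolynomial (Fin (n + 1)) k ⧸ I) →ₐ[k] k :=
    Ideal.Quotient.liftₐ I (aeval x) fun f hf => hx f hf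
  have hev : ∀ f, ev (Ideal.Quotient.mk I f) = eval x f := fun f => by
    simp [ev]
  have h := congrArg (fun y : gradedPiece I (d + 1) => ev y)
    (b'.sum_repr (mulForm I (isHomogeneous_X k j) d (b i)))
  simp only [AddSubmonoidClass.coe_finsetSum, Submodule.coe_smul, map_sum, map_smul, hb', hev,
    map_mul, hx1, mul_one, smul_eq_mul] at h
  simp only [Matrix.mulVec, dotProduct, projMulMatrix, Matrix.transpose_apply,
    LinearMap.toMatrix_apply, Pi.smul_apply, smul_eq_mul]
  rw [h]
  simp [mulForm, LinearMap.restrict_apply, hb, hev]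

/-- The zeros of `I` at which `l` is `1` give common eigenvectors. -/
theorem hasCommonEigenvector_eval
    (hb : ∀ i, (b i : MvPolynomial (Fin (n + 1)) k ⧸ I) = Ideal.Quotient.mk I (e i))
    (hb' : ∀ i, (b' i : MvPolynomial (Fin (n + 1)) k ⧸ I) = Ideal.Quotient.mk I (e i * l))
    {x : Fin (n + 1) → k} (hx : x ∈ zeroLocus k I) (hx1 : eval x l = 1) (hx0 : x ≠ 0) :
    HasCommonEigenvector (projMulMatrix I b b') x (fun i => eval x (e i)) := fun j => by
  rw [Module.End.hasEigenvector_iff, Module.End.mem_eigenspace_iff, Matrix.toLin'_apply]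
  exact ⟨mulVec_projMulMatrix hb hb' hx hx1 j, eval_basis_ne_zero hb hx hx0⟩

/-- Every common eigenvector comes from a zero of `I` at which `l` is `1`, whose coordinates are
the eigenvalues. -/
theorem eigenvalues_mem_zeroLocus (hI : I.IsHomogeneous (homogeneousSubmodule (Fin (n + 1)) k))
    (hdim : ∀ j, d ≤ j →
      Module.finrank k (gradedPiece I j) = Module.finrank k (gradedPiece I d))
    (hl : l.IsHomogeneous 1)
    (hb : ∀ i, (b i : MvPolynomial (Fin (n + 1)) k ⧸ I) = Ideal.Quotient.mk I (e i))
    (hb' : ∀ i, (b' i : MvPolynomial (Fin (n + 1)) k ⧸ I) = Ideal.Quotient.mk I (e i * l))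
    {lam : Fin (n + 1) → k} {v : Fin m → k}
    (hv : HasCommonEigenvector (projMulMatrix I b b') lam v) :
    lam ∈ zeroLocus k I ∧ eval lam l = 1 ∧ ∃ c : k, c ≠ 0 ∧ v = c • fun i => eval lam (e i) := by
  have hfin : Module.Finite k (gradedPiece I d) := Module.Finite.of_basis b
  let φ : gradedPiece I d →ₗ[k] k := b.constr k v
  let ψ : gradedPiece I (d + 1) →ₗ[k] k := b'.constr k v
  let Φ := φ ∘ₗ pieceClass I d
  let Ψ := ψ ∘ₗ pieceClass I (d + 1)
  have hφ : ∀ i, φ (b i) = v i := fun i => b.constr_basis k v i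
  have hψ : ∀ i, ψ (b' i) = v i := fun i => b'.constr_basis k v i
  -- Row `i` of the matrix expands `x_j b_i` in `b'`, so this is the eigenvector equation read entry
  -- by entry.
  have hψX : ∀ j, ψ ∘ₗ mulForm I (isHomogeneous_X k j) d = lam j • φ := by
    intro j
    refine b.ext fun i => ?_
    have h := congrFun ((Module.End.mem_eigenspace_iff).1 (hv j).1) i
    rw [Matrix.toLin'_apply] at h
    simp only [Matrix.mulVec, dotProduct, projMulMatrix, Matrix.transpose_apply,
      LinearMap.toMatrix_apply, Pi.smul_apply] at h
    rw [LinearMap.comp_apply, LinearMap.smul_apply, hφ, ← h]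
    conv_lhs => rw [← b'.sum_repr (mulForm I (isHomogeneous_X k j) d (b i))]
    simp only [map_sum, map_smul, hψ, smul_eq_mul]
  have hψl : ψ ∘ₗ mulForm I hl d = φ := b.ext fun i => by
    rw [LinearMap.comp_apply, mulForm_basis hl hb hb', hφ, hψ]
  have hX : ∀ j g, g.IsHomogeneous d → Ψ (X j * g) = lam j * Φ g := fun j g hg => by
    have := LinearMap.congr_fun (hψX j) (pieceClass I d g)
    rwa [LinearMap.comp_apply, mulForm_pieceClass _ hg] at this
  have hΨl : ∀ g, g.IsHomogeneous d → Ψ (l * g) = Φ g := fun g hg => by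
    have := LinearMap.congr_fun hψl (pieceClass I d g)
    rwa [LinearMap.comp_apply, mulForm_pieceClass _ hg] at this
  have hΦ : ∃ g, g.IsHomogeneous d ∧ Φ g ≠ 0 := by
    obtain ⟨i, hi⟩ := Function.ne_iff.1 (hv 0).2
    obtain ⟨f, hf, hfb, -⟩ := exists_form_of_basis hb i
    exact ⟨f, hf, by simpa [Φ, hfb, hφ] using hi⟩
  obtain ⟨hl1, hΦd, hΨd⟩ := eq_eval_of_intertwined hl hX hΨl hΦ
  have hc : Φ (l ^ d) ≠ 0 := by
    obtain ⟨g, hg, hg0⟩ := hΦ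
    exact fun h => hg0 (by rw [hΦd g hg, h, mul_zero])
  have hd : ∀ f ∈ I, f.IsHomogeneous d → eval lam f = 0 := fun f hf hfd => by
    have h0 : Φ f = 0 := by simp [Φ, pieceClass_eq_zero hfd hf]
    rw [hΦd f hfd] at h0
    exact (mul_eq_zero.1 h0).resolve_right hc
  let J := Ideal.span {u | u ∈ I ∧ u.IsHomogeneous (d + 1)}
  have hJI : J ≤ I := Ideal.span_le.2 fun u hu => hu.1
  have hJ : J ≤ RingHom.ker (eval lam) := Ideal.span_le.2 fun u hu => by
    have h0 : Ψ u = 0 := by simp [Ψ, pieceClass_eq_zero hu.2 hu.1]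
    rw [hΨd u hu.2] at h0
    exact (mul_eq_zero.1 h0).resolve_right hc
  have hmem : lam ∈ zeroLocus k I := by
    refine mem_zeroLocus_of_forms hI fun c f hf hfI => ?_
    -- Below `d`, multiply by `l ^ (d - c)`, which has value `1` at `lam`. Above, write `f` as `l ^
    -- s * g` modulo `J`; both `J` and `g` vanish at `lam`.
    rcases le_total c d with hcd | hcd
    · have := hd (l ^ (d - c) * f) (I.mul_mem_left _ hfI) (by
        have := (isHomogeneous_pow hl (d - c)).mul hf
        rwa [Nat.sub_add_cancel hcd] at this)
      simpa [hl1] using this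
    · obtain ⟨s, rfl⟩ := Nat.exists_eq_add_of_le hcd
      have hs := exists_sub_pow_mul_mem (exists_sub_mul_mem_span hl hb hb') s
      obtain ⟨g, hg, hfg⟩ := hs f hf
      have hgI : g ∈ I := by
        refine mem_of_pow_mul_mem (s := s) hl (fun f hf => ?_) (hdim _ hcd) hg ?_
        · obtain ⟨g, hg, hfg⟩ := hs f hf
          exact ⟨g, hg, hJI hfg⟩
        · simpa using I.sub_mem hfI (hJI hfg)
      have := RingHom.mem_ker.1 (hJ hfg)
      simpa [hd g hgI hg] using this
  refine ⟨hmem, hl1, Φ (l ^ d), hc, funext fun i => ?_⟩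
  obtain ⟨f, hf, hfb, hfe⟩ := exists_form_of_basis hb i
  have h₁ := eval_eq_zero_of_mem_zeroLocus hmem hfe
  rw [map_sub, sub_eq_zero] at h₁
  have h₂ := hΦd f hf
  rw [show Φ f = v i by simp [Φ, hfb, hφ]] at h₂
  simp [h₂, h₁, mul_comm]

/-- The zeros of `I` at which `l` is `1` are finite in number: their evaluation vectors are
linearly independent. -/
theorem finite_zeroLocus_inter (hl : l.IsHomogeneous 1)
    (hb : ∀ i, (b i : MvPolynomial (Fin (n + 1)) k ⧸ I) = Ideal.Quotient.mk I (e i))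
    (hb' : ∀ i, (b' i : MvPolynomial (Fin (n + 1)) k ⧸ I) = Ideal.Quotient.mk I (e i * l)) :
    {x : Fin (n + 1) → k | x ∈ zeroLocus k I ∧ eval x l = 1}.Finite := by
  set Z := {x : Fin (n + 1) → k | x ∈ zeroLocus k I ∧ eval x l = 1}
  let ev : Z → MvPolynomial (Fin (n + 1)) k →* k := fun x => (eval x.1 : _ →* k)
  have hev : Function.Injective ev := fun x y hxy => Subtype.ext <| funext fun j => by
    simpa [ev] using DFunLike.congr_fun hxy (X j)
  -- Dedekind: distinct evaluations are independent as characters. It remains to see that a relation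
  -- holding on the `e i` holds on all polynomials.
  have hind := (linearIndependent_monoidHom (MvPolynomial (Fin (n + 1)) k) k).comp ev hev
  have : LinearIndependent k fun (x : Z) (i : Fin m) => eval x.1 (e i) := by
    rw [linearIndependent_iff'] at hind ⊢
    intro t c hc
    refine hind t c (funext fun f => ?_)
    let F : MvPolynomial (Fin (n + 1)) k →ₗ[k] k := ∑ x ∈ t, c x • (aeval x.1).toLinearMap
    have hF : ∀ f, F f = ∑ x ∈ t, c x * eval x.1 f := fun f => by
      simp [F, aeval_eq_eval]
    suffices F f = 0 by simpa [hF, ev] using this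
    have hFe : ∀ i, F (e i) = 0 := fun i => by
      simpa [hF] using congrFun hc i
    have hFI : ∀ f ∈ I, F f = 0 := fun f hf => by
      rw [hF]
      exact Finset.sum_eq_zero fun x _ => by
        rw [eval_eq_zero_of_mem_zeroLocus x.2.1 hf, mul_zero]
    have hFl : ∀ s f, F (l ^ s * f) = F f := fun s f => by
      rw [hF, hF]
      exact Finset.sum_congr rfl fun x _ => by simp [x.2.2]
    have hFd : ∀ f, f.IsHomogeneous d → F f = 0 := fun f hf => by
      obtain ⟨a, ha⟩ := exists_sub_sum_mem hb hf
      have := hFI _ ha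
      rw [map_sub, sub_eq_zero] at this
      simp [this, hFe]
    -- `F` kills `I` and ignores factors of `l`, so every component reduces to degree `d`.
    rw [← sum_homogeneousComponent f, map_sum]
    refine Finset.sum_eq_zero fun a _ => ?_
    have hf := homogeneousComponent_isHomogeneous a f
    rcases le_total a d with had | had
    · rw [← hFl (d - a)]
      refine hFd _ ?_
      have := (isHomogeneous_pow hl (d - a)).mul hf
      rwa [Nat.sub_add_cancel had] at this
    · obtain ⟨s, rfl⟩ := Nat.exists_eq_add_of_le had
      obtain ⟨g, hg, hfg⟩ := exists_sub_pow_mul_mem (exists_sub_mul_mem_span hl hb hb') s _ hf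
      have := hFI _ (Ideal.span_le.2 (fun u hu => hu.1) hfg)
      rwa [map_sub, hFl, hFd g hg, sub_zero] at this
  have := this.finite
  exact Set.toFinite Z

theorem IsCommonEigenvector.smul {A : Fin (n + 1) → Matrix (Fin m) (Fin m) k} {v : Fin m → k}
    (h : IsCommonEigenvector A v) {c : k} (hc : c ≠ 0) : IsCommonEigenvector A (c • v) := by
  obtain ⟨lam, h⟩ := h
  exact ⟨lam, fun j => ⟨Submodule.smul_mem _ c (h j).1, smul_ne_zero hc (h j).2⟩⟩

end Pieces

end ProjMult

/-! ### The correspondence between points and common eigenvectors. -/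

open ProjMult in
theorem theorem3 {k : Type*} [Field k] {n : ℕ}
    (I : Ideal (MvPolynomial (Fin (n + 1)) k)) (hI : ProjMult.IsProjDimZero I)
    -- a minimal primary decomposition of `I`, from which `I^u` and `nz` are computed
    (t : Finset (Ideal (MvPolynomial (Fin (n + 1)) k)))
    (ht : Submodule.IsMinimalPrimaryDecomposition I t)
    -- `k` has at least `|V(I)|` elements
    (hk : (ProjMult.projVariety I).encard ≤ ENat.card k)
    -- `[e_1], …, [e_m]` is a basis of `R_nz`
    {m : ℕ} (e : Fin m → MvPolynomial (Fin (n + 1)) k)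
    (b : Module.Basis (Fin m) k (ProjMult.gradedPiece I (ProjMult.nz I t)))
    (hb : ∀ i, (b i : MvPolynomial (Fin (n + 1)) k ⧸ I) = Ideal.Quotient.mk I (e i))
    -- `[e_1 l], …, [e_m l]` is a basis of `R_{nz+1}`
    (l : MvPolynomial (Fin (n + 1)) k) (hl : l.IsHomogeneous 1)
    (b' : Module.Basis (Fin m) k (ProjMult.gradedPiece I (ProjMult.nz I t + 1)))
    (hb' : ∀ i, (b' i : MvPolynomial (Fin (n + 1)) k ⧸ I) = Ideal.Quotient.mk I (e i * l))
    -- a fixed choice of an affine representative of each projective point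
    (a : Projectivization k (Fin (n + 1) → k) → Fin (n + 1) → k)
    (ha : ∀ p, ∃ h : a p ≠ 0, Projectivization.mk k (a p) h = p) :
    -- there are exactly `r = |V(I)|` common eigenvectors, up to scaling
    (ProjMult.projVariety I).Finite ∧
    (ProjMult.commonEigenlines (ProjMult.projMulMatrix I b b')).Finite ∧
    (ProjMult.commonEigenlines (ProjMult.projMulMatrix I b b')).ncard =
      (ProjMult.projVariety I).ncard ∧
    -- the vectors `(e_1(p), …, e_m(p))` with `p ∈ V(I)` are common eigenvectors
    (∀ p ∈ ProjMult.projVariety I,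
      ProjMult.IsCommonEigenvector (ProjMult.projMulMatrix I b b')
        (fun i => MvPolynomial.eval (a p) (e i))) ∧
    -- every common eigenvector is, up to scaling, one of them, for a unique point
    (∀ v : Fin m → k, ProjMult.IsCommonEigenvector (ProjMult.projMulMatrix I b b') v →
      ∃! p, p ∈ ProjMult.projVariety I ∧
        ∃ c : k, c ≠ 0 ∧ v = c • fun i => MvPolynomial.eval (a p) (e i)) ∧
    -- the corresponding eigenvalues are homogeneous coordinates of the point
    (∀ p ∈ ProjMult.projVariety I, ∀ lam : Fin (n + 1) → k,
      ProjMult.HasCommonEigenvector (ProjMult.projMulMatrix I b b') lam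
        (fun i => MvPolynomial.eval (a p) (e i)) →
      ∃ h : lam ≠ 0, Projectivization.mk k lam h = p) := by
  obtain ⟨hIh, M, -, N, hN⟩ := hI
  have hdim : ∀ j, nz I t ≤ j →
      Module.finrank k (gradedPiece I j) = Module.finrank k (gradedPiece I (nz I t)) := by
    have hpost : post I ∈ {i | ∀ j, i ≤ j →
        Module.finrank k (gradedPiece I j) = Module.finrank k (gradedPiece I i)} :=
      Nat.sInf_mem ⟨N, fun j hj => by rw [hN j hj, hN N le_rfl]⟩
    have hle : post I ≤ nz I t := le_max_left _ _
    exact fun j hj => (hpost j (hle.trans hj)).trans (hpost _ hle).symm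
  have ha0 : ∀ p, a p ≠ 0 := fun p => (ha p).1
  have hmk : ∀ p, Projectivization.mk k (a p) (ha0 p) = p := fun p => (ha p).2
  have hmem : ∀ p, p ∈ projVariety I ↔ a p ∈ MvPolynomial.zeroLocus k I := by
    intro p
    obtain ⟨c, hc⟩ := Projectivization.exists_smul_eq_mk_rep k (a p) (ha0 p)
    rw [hmk, Units.smul_def] at hc
    change p.rep ∈ MvPolynomial.zeroLocus k I ↔ _
    refine ⟨fun h => ?_, fun h => hc ▸ smul_mem_zeroLocus hIh h c⟩
    have := smul_mem_zeroLocus hIh h (c : k)⁻¹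
    rwa [← hc, smul_smul, inv_mul_cancel₀ c.ne_zero, one_smul] at this
  let w : Projectivization k (Fin (n + 1) → k) → Fin m → k :=
    fun p i => MvPolynomial.eval (a p) (e i)
  -- the representative of a point at which `l` takes the value `1`
  let x : Projectivization k (Fin (n + 1) → k) → Fin (n + 1) → k :=
    fun p => (MvPolynomial.eval (a p) l)⁻¹ • a p
  have hla : ∀ p ∈ projVariety I, MvPolynomial.eval (a p) l ≠ 0 := fun p hp =>
    eval_linearForm_ne_zero hb' ((hmem p).1 hp) (ha0 p)
  have hx0 : ∀ p ∈ projVariety I, x p ≠ 0 := fun p hp =>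
    smul_ne_zero (inv_ne_zero (hla p hp)) (ha0 p)
  have hxmk : ∀ p (hp : p ∈ projVariety I), Projectivization.mk k (x p) (hx0 p hp) = p := by
    intro p hp
    conv_rhs => rw [← hmk p]
    exact (Projectivization.mk_eq_mk_iff' k _ _ _ _).2 ⟨_, rfl⟩
  have hxZ : ∀ p ∈ projVariety I, x p ∈ MvPolynomial.zeroLocus k I := fun p hp =>
    smul_mem_zeroLocus hIh ((hmem p).1 hp) _
  have hxl : ∀ p ∈ projVariety I, MvPolynomial.eval (x p) l = 1 := fun p hp => by
    rw [eval_smul_of_isHomogeneous hl, pow_one, inv_mul_cancel₀ (hla p hp)]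
  have hxw : ∀ p ∈ projVariety I, (fun i => MvPolynomial.eval (x p) (e i)) =
      (MvPolynomial.eval (a p) l)⁻¹ ^ nz I t • w p := fun p hp =>
    eval_smul_of_basis hb hIh ((hmem p).1 hp) _
  have hw0 : ∀ p ∈ projVariety I, w p ≠ 0 := fun p hp =>
    eval_basis_ne_zero hb ((hmem p).1 hp) (ha0 p)
  have hwx : ∀ p ∈ projVariety I,
      HasCommonEigenvector (projMulMatrix I b b') (x p) (w p) := by
    intro p hp j
    have h := hasCommonEigenvector_eval hb hb' (hxZ p hp) (hxl p hp) (hx0 p hp) j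
    rw [hxw p hp] at h
    have hs : (MvPolynomial.eval (a p) l)⁻¹ ^ nz I t ≠ 0 := pow_ne_zero _ (inv_ne_zero (hla p hp))
    exact ⟨((Submodule.smul_mem_iff _ hs).1 h.1), hw0 p hp⟩
  have hlam : ∀ p ∈ projVariety I, ∀ lam,
      HasCommonEigenvector (projMulMatrix I b b') lam (w p) → lam = x p := by
    intro p hp lam h
    funext j
    have h₁ := (Module.End.mem_eigenspace_iff).1 (h j).1
    rw [(Module.End.mem_eigenspace_iff).1 (hwx p hp j).1] at h₁
    exact (smul_left_injective k (hw0 p hp) h₁).symm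
  have hex : ∀ v, IsCommonEigenvector (projMulMatrix I b b') v →
      ∃ p ∈ projVariety I, ∃ c : k, c ≠ 0 ∧ v = c • w p := by
    rintro v ⟨lam, hv⟩
    obtain ⟨hZ, hl1, c, hc, rfl⟩ := eigenvalues_mem_zeroLocus hIh hdim hl hb hb' hv
    have hlam0 : lam ≠ 0 := by
      rintro rfl
      have := eval_smul_of_isHomogeneous hl 0 (0 : Fin (n + 1) → k)
      rw [smul_zero, hl1, pow_one, zero_mul] at this
      exact one_ne_zero this
    let p := Projectivization.mk k lam hlam0
    obtain ⟨s, hs⟩ := (Projectivization.mk_eq_mk_iff k _ _ (ha0 p) hlam0).1 (hmk p)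
    rw [Units.smul_def] at hs
    -- Since `a p = s • lam`, the evaluation vectors differ by the factor `s ^ nz I t`.
    refine ⟨p, (hmem p).2 (hs ▸ smul_mem_zeroLocus hIh hZ s), c * ((s : k) ^ nz I t)⁻¹,
      mul_ne_zero hc (inv_ne_zero (pow_ne_zero _ s.ne_zero)), ?_⟩
    have hw : w p = (s : k) ^ nz I t • fun i => MvPolynomial.eval lam (e i) := by
      rw [← eval_smul_of_basis hb hIh hZ, hs]
    rw [hw, smul_smul, mul_assoc, inv_mul_cancel₀ (pow_ne_zero _ s.ne_zero), mul_one]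
  have hinj : ∀ p ∈ projVariety I, ∀ q ∈ projVariety I, ∀ c : k, c ≠ 0 → w p = c • w q →
      p = q := by
    intro p hp q hq c hc h
    -- Proportional eigenvectors have equal eigenvalues, and these are the normalized coordinates.
    have hpq : x q = x p := hlam p hp (x q) fun j => by
      rw [h]
      exact ⟨Submodule.smul_mem _ c (hwx q hq j).1, smul_ne_zero hc (hwx q hq j).2⟩
    rw [← hxmk p hp, ← hxmk q hq]
    simp only [hpq]
  have hfin : (projVariety I).Finite := by
    have hmaps : Set.MapsTo x (projVariety I)
        {y | y ∈ MvPolynomial.zeroLocus k I ∧ MvPolynomial.eval y l = 1} :=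
      fun p hp => ⟨hxZ p hp, hxl p hp⟩
    refine Set.Finite.of_injOn hmaps ?_ (finite_zeroLocus_inter hl hb hb')
    intro p hp q hq hpq
    rw [← hxmk p hp, ← hxmk q hq]
    simp only [hpq]
  let L : ∀ p ∈ projVariety I, Projectivization k (Fin m → k) :=
    fun p hp => Projectivization.mk k (w p) (hw0 p hp)
  have hLsurj : ∀ y ∈ commonEigenlines (projMulMatrix I b b'), ∃ p hp, L p hp = y := by
    intro y hy
    obtain ⟨p, hp, c, hc, h⟩ := hex y.rep hy
    refine ⟨p, hp, ?_⟩
    rw [← y.mk_rep]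
    exact (Projectivization.mk_eq_mk_iff' k _ _ _ _).2
      ⟨c⁻¹, by rw [h, smul_smul, inv_mul_cancel₀ hc, one_smul]⟩
  refine ⟨hfin, (hfin.dependent_image L).subset hLsurj, (Set.ncard_congr L ?_ ?_ hLsurj).symm,
    fun p hp => ⟨x p, hwx p hp⟩, ?_, ?_⟩
  · intro p hp
    obtain ⟨c, hc⟩ := Projectivization.exists_smul_eq_mk_rep k (w p) (hw0 p hp)
    change IsCommonEigenvector _ (L p hp).rep
    rw [← hc, Units.smul_def]
    exact IsCommonEigenvector.smul ⟨x p, hwx p hp⟩ c.ne_zero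
  · intro p q hp hq h
    obtain ⟨c, hc⟩ := (Projectivization.mk_eq_mk_iff k _ _ _ _).1 h
    exact hinj p hp q hq c c.ne_zero hc.symm
  · intro v hv
    obtain ⟨p, hp, c, hc, rfl⟩ := hex v hv
    refine ⟨p, ⟨hp, c, hc, rfl⟩, ?_⟩
    rintro q ⟨hq, c', hc', h⟩
    refine hinj q hq p hp (c'⁻¹ * c) (mul_ne_zero (inv_ne_zero hc') hc) ?_
    rw [mul_smul, h, smul_smul, inv_mul_cancel₀ hc', one_smul]
  · intro p hp lam h
    obtain rfl := hlam p hp lam h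
    exact ⟨hx0 p hp, hxmk p hp⟩
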